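/- Let $\mu>0$ and let $z\in\mathbb{C}$ with $z\neq 1$ and $|z|\le 1$. For $r>0$ the Mathieu power series $$F_\mu(r,z)=\sum_{n=1}^\infty \frac{2n z^n}{(n^2+r^2)^{\mu+1}}$$ converges absolutely. As $r\to\infty$ it has the asymptotic expansion $$F_\mu(r,z)\sim\sum_{k=0}^\infty \frac{2(-1)^k\,\Gamma(k+\mu+1)}{k!\,\Gamma(\mu+1)}\,\mathrm{Li}_{-2k-1}(z)\,r^{-2k-2\mu-2} =2\sum_{k=0}^\infty(-1)^k\binom{k+\mu}{k}\,\mathrm{Li}_{-2k-1}(z)\,r^{-2k-2\mu-2},$$ where the equality means that the coefficients agree term by term, and $f(r)\sim\sum_{k\ge0}a_k r^{-2k-2\mu-2}$ means that $f(r)-\sum_{k=0}^{N}a_k r^{-2k-2\mu-2}=o(r^{-2N-2\mu-2})$ as $r\to\infty$, for every integer $N\ge 0$. Here $\mathrm{Li}_\alpha(z)=\sum_{n=1}^\infty z^n/n^\alpha$ for $|z|<1$, and for $|z|=1$, $z\ne1$, the polylogarithm $\mathrm{Li}_\alpha(z)$ is the analytic continuation given by the Lindelöf integral $$\mathrm{Li}_\alpha(z)=-\frac1{2\pi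 i}\int_{1/2-i\infty}^{1/2+i\infty}\frac{(-z)^u}{u^\alpha}\,\frac{\pi}{\sin \pi u}\,du$$ with principal branches of the powers. -/

import Mathlib

open Filter Asymptotics MeasureTheory

/-- The `n`-th term `2 n zⁿ / (n² + r²)^(μ+1)` of the Mathieu power series.
The base and the exponent of the power in the denominator are real. -/
noncomputable def mathieuTerm (μ r : ℝ) (z : ℂ) (n : ℕ) : ℂ :=
  2 * (n : ℂ) * z ^ n / (((((n : ℝ) ^ 2 + r ^ 2) ^ (μ + 1) : ℝ)) : ℂ)

/-- The Mathieu power series `F_μ(r, z) = ∑_{n ≥ 1} 2 n zⁿ / (n² + r²)^(μ+1)`; the sum starts at `n = 1`. -/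
noncomputable def mathieuF (μ r : ℝ) (z : ℂ) : ℂ :=
  ∑' n : ℕ, mathieuTerm μ r z (n + 1)

/-- The polylogarithm series `∑_{n ≥ 1} zⁿ / n^α`, for `|z| < 1` and `α ∈ ℂ`. -/
noncomputable def polylogSeries (α z : ℂ) : ℂ :=
  ∑' n : ℕ, z ^ (n + 1) / ((n + 1 : ℕ) : ℂ) ^ α

/-- The integrand of the Lindelöf integral, `(-z)^u / u^α * π / sin (π u)`, with principal
branches of both powers. -/
noncomputable def lindelofIntegrand (α z u : ℂ) : ℂ :=
  (-z) ^ u / u ^ α * ((Real.pi : ℂ) / Complex.sin ((Real.pi : ℂ) * u))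

/-- The Lindelöf integral `-1/(2πi) ∫ (-z)^u / u^α * π / sin (π u) du` over the vertical line
`Re u = 1/2`, parametrized by `u = 1/2 + i t`, `du = i dt`. It converges absolutely for
`z ∈ ℂ \ [0, ∞)` and every `α ∈ ℂ`, and continues the polylogarithm series analytically. -/
noncomputable def lindelofIntegral (α z : ℂ) : ℂ :=
  -(1 / (2 * (Real.pi : ℂ) * Complex.I)) *
    ∫ t : ℝ, lindelofIntegrand α z (1 / 2 + (t : ℂ) * Complex.I) * Complex.I

open Classical in
/-- The polylogarithm `Li_α(z)`, `z ∈ ℂ \ [1, ∞)`, `α ∈ ℂ`: the power series in the open unit disk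
and its analytic continuation, given by the Lindelöf integral, outside of it. -/
noncomputable def polylog (α z : ℂ) : ℂ :=
  if ‖z‖ < 1 then polylogSeries α z else lindelofIntegral α z

/-- `f ∼ ∑_{k ≥ 0} a k * φ k` as an asymptotic (Poincaré) expansion along `atTop`, with respect
to the asymptotic scale `φ`: each `φ (k+1)` is negligible against `φ k`, and the difference of `f`
and the partial sum up to the term of index `N` is negligible against `φ N`, for every `N`. -/
def HasAsymptoticExpansion (f : ℝ → ℂ) (a : ℕ → ℂ) (φ : ℕ → ℝ → ℝ) : Prop :=
  (∀ k : ℕ, φ (k + 1) =o[atTop] φ k) ∧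
  ∀ N : ℕ, (fun r : ℝ => f r - ∑ k ∈ Finset.range (N + 1), a k * (φ k r : ℂ)) =o[atTop] φ N

/-! Both cases `‖z‖ < 1` and `‖z‖ = 1` come from one representation: `F_μ(r, z) = ∫ W · g_r(U) dm`
with `g_r(u) = 2u (u² + r²)^(-(μ+1))` and `Re U ≥ 1/2`. The odd moments `∫ W U^(2k+1) dm` are
exactly `Li_{-2k-1}(z)`. Inside the disk `m` is counting measure, `W = zⁿ` and `U = n`; on the
circle `m` lives on the line `Re u = 1/2` and `W` is the Lindelöf kernel. The binomial series of
`g_r` in `(u/r)²` diverges for large `u`, but its remainder is bounded by a power of `1 + |u|` times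
the next power of `r`, for all `Re u ≥ 1/2` (`exists_norm_sq_add_sq_cpow_sub_sum_le`). Since `W`
integrates every polynomial weight, integrating termwise gives the expansion
(`hasAsymptoticExpansion_integral`). On the circle the representation of `F_μ` needs proof. Moving
the line right by one picks up the residue at `u = 1` and multiplies the kernel by `z`; iteration
produces the partial sums, and the leftover integral vanishes because `g_r` decays as `Re u → ∞`
(`tendsto_sum_pow_mul_lindelof`). -/

/-! ### Binomial expansion with a remainder uniform in the half-plane -/

theorem exists_norm_one_add_cpow_sub_sum_le (c : ℂ) (N : ℕ) :
    ∃ δ > 0, ∃ C ≥ 0, ∀ w : ℂ, ‖w‖ ≤ δ →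
      ‖(1 + w) ^ c - ∑ k ∈ Finset.range N, Ring.choose c k * w ^ k‖ ≤ C * ‖w‖ ^ N := by
  have h := (Complex.one_add_cpow_hasFPowerSeriesAt_zero (a := c)).isBigO_sub_partialSum_pow N
  obtain ⟨C, hC, h⟩ := h.exists_nonneg
  rw [IsBigOWith] at h
  obtain ⟨δ, hδ, h⟩ := Metric.eventually_nhds_iff.1 h
  refine ⟨δ / 2, by positivity, C, hC, fun w hw => ?_⟩
  have := h (y := w) (by rw [dist_zero_right]; linarith)
  simpa [FormalMultilinearSeries.partialSum, binomialSeries, mul_comm] using this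

/-- In `u² + r² = (u + ir)(u - ir)` both factors have modulus at least `|Re u|`, and the larger has
modulus at least `|u|`. This keeps `u² + r²` away from `0` uniformly in `r`, even near `u = ±ir`. -/
theorem norm_mul_re_le_norm_sq_add_sq (u : ℂ) (r : ℝ) :
    ‖u‖ * u.re ≤ ‖u ^ 2 + (r : ℂ) ^ 2‖ := by
  apply le_of_sq_le_sq _ (norm_nonneg _)
  rw [mul_pow, ← Complex.normSq_eq_norm_sq, ← Complex.normSq_eq_norm_sq]
  simp only [Complex.normSq_apply, Complex.add_re, Complex.add_im, pow_two, Complex.mul_re,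
    Complex.mul_im, Complex.ofReal_re, Complex.ofReal_im]
  nlinarith [sq_nonneg (u.re * u.im), sq_nonneg (u.re ^ 2), sq_nonneg (u.im ^ 2 - r ^ 2),
    sq_nonneg (u.re * r)]

theorem sq_add_sq_mem_slitPlane {u : ℂ} (hu : 0 < u.re) (r : ℝ) :
    u ^ 2 + (r : ℂ) ^ 2 ∈ Complex.slitPlane := by
  rw [Complex.mem_slitPlane_iff]
  simp only [Complex.add_re, Complex.add_im, pow_two, Complex.mul_re,
    Complex.mul_im, Complex.ofReal_re, Complex.ofReal_im]
  by_cases h : u.im = 0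
  · left; rw [h]; nlinarith [mul_self_nonneg r]
  · right
    have := mul_ne_zero hu.ne' h
    intro h'; apply this; linarith

theorem norm_cpow_ofReal_of_ne_zero {w : ℂ} (hw : w ≠ 0) (c : ℝ) :
    ‖w ^ (c : ℂ)‖ = ‖w‖ ^ c := by
  rw [Complex.norm_cpow_of_ne_zero hw]; simp

theorem ofReal_mul_cpow_ofReal {a : ℝ} (ha : 0 < a) {w : ℂ} (hw : w ≠ 0) (c : ℂ) :
    ((a : ℂ) * w) ^ c = (a : ℂ) ^ c * w ^ c := by
  have ha' : (a : ℂ) ≠ 0 := by exact_mod_cast ha.ne'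
  rw [Complex.cpow_def_of_ne_zero (mul_ne_zero ha' hw), Complex.cpow_def_of_ne_zero ha',
    Complex.cpow_def_of_ne_zero hw, Complex.log_ofReal_mul ha hw, ← Complex.exp_add,
    Complex.ofReal_log ha.le, add_mul]

theorem norm_sq_add_sq_cpow_neg_le {ν : ℝ} (hν : 0 ≤ ν) {u : ℂ} (hu : 0 < u.re) (r : ℝ) :
    ‖(u ^ 2 + (r : ℂ) ^ 2) ^ ((-ν : ℝ) : ℂ)‖ ≤ (‖u‖ * u.re) ^ (-ν) := by
  have hu0 : 0 < ‖u‖ := norm_pos_iff.2 (fun h => by simp [h] at hu)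
  rw [norm_cpow_ofReal_of_ne_zero (Complex.slitPlane_ne_zero (sq_add_sq_mem_slitPlane hu r))]
  exact Real.rpow_le_rpow_of_nonpos (by positivity)
    (norm_mul_re_le_norm_sq_add_sq u r) (by linarith)

/-- With `w = (u/r)²`, small `w` is covered by Taylor's bound. Otherwise `r² ≤ A|u|²`, so every
positive power of `r` can be paid for by powers of `|u|`, and the function and its partial sum are
bounded separately. -/
theorem exists_norm_sq_add_sq_cpow_sub_sum_le {ν : ℝ} (hν : 0 ≤ ν) (N : ℕ) :
    ∃ K ≥ 0, ∃ Q : ℕ, ∀ r : ℝ, 1 ≤ r → ∀ u : ℂ, 1 / 2 ≤ u.re →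
      ‖(u ^ 2 + (r : ℂ) ^ 2) ^ ((-ν : ℝ) : ℂ) - ∑ k ∈ Finset.range N,
        Ring.choose ((-ν : ℝ) : ℂ) k * u ^ (2 * k) * ((r ^ (-2 * (k : ℝ) - 2 * ν) : ℝ) : ℂ)‖ ≤
      K * (1 + ‖u‖) ^ Q * r ^ (-2 * (N : ℝ) - 2 * ν) := by
  obtain ⟨δ, hδ, C, hC, h⟩ := exists_norm_one_add_cpow_sub_sum_le ((-ν : ℝ) : ℂ) N
  obtain ⟨M, hM⟩ := exists_nat_ge ν
  set S : ℝ := ∑ k ∈ Finset.range N, ‖Ring.choose ((-ν : ℝ) : ℂ) k‖ with hS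
  have hS0 : 0 ≤ S := Finset.sum_nonneg fun _ _ => norm_nonneg _
  set A : ℝ := (1 + δ⁻¹) with hA
  have hA1 : 1 ≤ A := by rw [hA]; have := inv_pos.2 hδ; linarith
  have hA0 : 0 ≤ A := by linarith
  -- The three summands serve small `w`, the power for large `w`, and the partial sum for large `w`.
  -- The integer `M ≥ ν` replaces `r^(2ν)` by an integer power.
  refine ⟨C + A ^ (N + M) * 4 ^ ν + S * A ^ N, by positivity, 2 * (N + M), ?_⟩
  intro r hr u hu
  have hr0 : 0 < r := by linarith
  have hu' : 0 < u.re := by linarith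
  have hune : u ≠ 0 := fun h => by simp [h] at hu'
  have hub : 1 / 2 ≤ ‖u‖ := hu.trans (Complex.re_le_norm u)
  set w : ℂ := (u / r) ^ 2 with hw
  have hrC : (r : ℂ) ≠ 0 := by exact_mod_cast hr0.ne'
  have hnw : ‖w‖ = ‖u‖ ^ 2 / r ^ 2 := by
    rw [hw, norm_pow, norm_div, Complex.norm_real, Real.norm_of_nonneg hr0.le, div_pow]
  have hfac : u ^ 2 + (r : ℂ) ^ 2 = ((r ^ 2 : ℝ) : ℂ) * (1 + w) := by
    rw [hw]; push_cast; field_simp; ring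
  have hne := Complex.slitPlane_ne_zero (sq_add_sq_mem_slitPlane hu' r)
  have h1w : 1 + w ≠ 0 := fun h => hne (by rw [hfac, h, mul_zero])
  have hrν : (((r ^ 2 : ℝ) : ℂ)) ^ ((-ν : ℝ) : ℂ) = ((r ^ (-2 * ν) : ℝ) : ℂ) := by
    rw [← Complex.ofReal_cpow (by positivity), ← Real.rpow_natCast, ← Real.rpow_mul hr0.le]
    norm_num
  have hexp : ∀ k : ℕ, r ^ (-2 * (k : ℝ) - 2 * ν) = r ^ (-2 * ν) * (r ^ (2 * k))⁻¹ := by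
    intro k
    rw [show -2 * (k : ℝ) - 2 * ν = -2 * ν + -((2 * k : ℕ) : ℝ) by push_cast; ring,
      Real.rpow_add hr0, Real.rpow_neg hr0.le, Real.rpow_natCast]
  have hwk : ∀ k : ℕ, w ^ k = u ^ (2 * k) * (((r ^ (2 * k))⁻¹ : ℝ) : ℂ) := by
    intro k
    rw [hw, ← pow_mul, div_pow]; push_cast; rfl
  have key : (u ^ 2 + (r : ℂ) ^ 2) ^ ((-ν : ℝ) : ℂ) - ∑ k ∈ Finset.range N,
        Ring.choose ((-ν : ℝ) : ℂ) k * u ^ (2 * k) * ((r ^ (-2 * (k : ℝ) - 2 * ν) : ℝ) : ℂ) =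
      ((r ^ (-2 * ν) : ℝ) : ℂ) * ((1 + w) ^ ((-ν : ℝ) : ℂ) -
        ∑ k ∈ Finset.range N, Ring.choose ((-ν : ℝ) : ℂ) k * w ^ k) := by
    rw [hfac, ofReal_mul_cpow_ofReal (by positivity) h1w, hrν, mul_sub, Finset.mul_sum]
    congr 1
    refine Finset.sum_congr rfl fun k _ => ?_
    rw [hexp, hwk]; push_cast; ring
  have hX : ∀ n ≤ 2 * (N + M), ‖u‖ ^ n ≤ (1 + ‖u‖) ^ (2 * (N + M)) := fun n hn =>
    (pow_le_pow_left₀ (norm_nonneg _) (by linarith) n).trans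
      (pow_le_pow_right₀ (by linarith [norm_nonneg u]) hn)
  set X := (1 + ‖u‖) ^ (2 * (N + M)) with hXdef
  have hX0 : 0 ≤ X := by positivity
  rw [key, norm_mul, Complex.norm_real, Real.norm_of_nonneg (by positivity), hexp]
  have hpos : 0 < r ^ (-2 * ν) := by positivity
  rw [mul_left_comm]
  refine mul_le_mul_of_nonneg_left ?_ hpos.le
  rw [← div_eq_mul_inv, le_div_iff₀ (by positivity)]
  rcases le_or_gt ‖w‖ δ with hwδ | hwδ
  · calc _ ≤ C * ‖w‖ ^ N * r ^ (2 * N) := by gcongr; exact h w hwδ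
      _ = C * ‖u‖ ^ (2 * N) := by
        rw [hnw, div_pow, ← pow_mul, ← pow_mul]; field_simp
      _ ≤ C * X := by gcongr; exact hX _ (by omega)
      _ ≤ _ := by
        rw [add_assoc, add_mul]
        have : 0 ≤ (A ^ (N + M) * 4 ^ ν + S * A ^ N) * X := by positivity
        linarith
  · have hr2 : r ^ 2 ≤ A * ‖u‖ ^ 2 := by
      rw [hnw, lt_div_iff₀ (by positivity)] at hwδ
      have : r ^ 2 < δ⁻¹ * ‖u‖ ^ 2 := by
        rw [inv_mul_eq_div, lt_div_iff₀ hδ]; linarith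
      rw [hA]; nlinarith [sq_nonneg ‖u‖]
    have hrn : ∀ n : ℕ, r ^ (2 * n) ≤ A ^ n * ‖u‖ ^ (2 * n) := fun n => by
      rw [pow_mul, pow_mul, ← mul_pow]; gcongr
    -- Here `1 + w` may be close to `0`; `|u| · Re u ≥ 1/4` limits the size of the negative power.
    have t1 : ‖(1 + w) ^ ((-ν : ℝ) : ℂ)‖ ≤ r ^ (2 * M) * 4 ^ ν := by
      have e : (1 + w) ^ ((-ν : ℝ) : ℂ) = ((r ^ (2 * ν) : ℝ) : ℂ) *
          (u ^ 2 + (r : ℂ) ^ 2) ^ ((-ν : ℝ) : ℂ) := by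
        rw [hfac, ofReal_mul_cpow_ofReal (by positivity) h1w, hrν, ← mul_assoc,
          ← Complex.ofReal_mul, ← Real.rpow_add hr0]
        simp
      rw [e, norm_mul, Complex.norm_real, Real.norm_of_nonneg (by positivity)]
      gcongr
      · rw [← Real.rpow_natCast]
        exact Real.rpow_le_rpow_of_exponent_le hr (by push_cast; linarith)
      · refine (norm_sq_add_sq_cpow_neg_le hν hu' r).trans ?_
        rw [Real.rpow_neg (by positivity), ← Real.inv_rpow (by positivity)]
        refine Real.rpow_le_rpow (by positivity) ?_ hν
        rw [inv_le_comm₀ (by positivity) (by norm_num)]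
        nlinarith
    have t2 : ‖∑ k ∈ Finset.range N, Ring.choose ((-ν : ℝ) : ℂ) k * w ^ k‖ * r ^ (2 * N) ≤
        S * A ^ N * X := by
      calc _ ≤ (∑ k ∈ Finset.range N, ‖Ring.choose ((-ν : ℝ) : ℂ) k‖ * ‖w‖ ^ k) * r ^ (2 * N) := by
            gcongr
            refine (norm_sum_le _ _).trans_eq ?_
            simp
        _ = ∑ k ∈ Finset.range N, ‖Ring.choose ((-ν : ℝ) : ℂ) k‖ * (‖w‖ ^ k * r ^ (2 * N)) := by
            rw [Finset.sum_mul]; exact Finset.sum_congr rfl fun _ _ => by ring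
        _ ≤ ∑ k ∈ Finset.range N, ‖Ring.choose ((-ν : ℝ) : ℂ) k‖ * (A ^ N * X) := by
            refine Finset.sum_le_sum fun k hk => ?_
            refine mul_le_mul_of_nonneg_left ?_ (norm_nonneg _)
            have hk' := (Finset.mem_range.1 hk).le
            obtain ⟨d, rfl⟩ := Nat.exists_eq_add_of_le hk'
            calc ‖w‖ ^ k * r ^ (2 * (k + d)) = ‖u‖ ^ (2 * k) * r ^ (2 * d) := by
                  rw [hnw, div_pow, ← pow_mul, ← pow_mul, mul_add, pow_add]; field_simp
              _ ≤ ‖u‖ ^ (2 * k) * (A ^ d * ‖u‖ ^ (2 * d)) := by gcongr; exact hrn d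
              _ = A ^ d * ‖u‖ ^ (2 * (k + d)) := by ring
              _ ≤ A ^ (k + d) * X := by
                  gcongr
                  · omega
                  · exact hX _ (by omega)
        _ = S * A ^ N * X := by rw [hS, ← Finset.sum_mul]; ring
    have t1' : ‖(1 + w) ^ ((-ν : ℝ) : ℂ)‖ * r ^ (2 * N) ≤ A ^ (N + M) * 4 ^ ν * X := by
      calc _ ≤ r ^ (2 * M) * 4 ^ ν * r ^ (2 * N) := by gcongr
        _ = r ^ (2 * (N + M)) * 4 ^ ν := by ring
        _ ≤ A ^ (N + M) * ‖u‖ ^ (2 * (N + M)) * 4 ^ ν := by gcongr; exact hrn _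
        _ ≤ A ^ (N + M) * X * 4 ^ ν := by gcongr; exact hX _ le_rfl
        _ = _ := by ring
    calc _ ≤ (‖(1 + w) ^ ((-ν : ℝ) : ℂ)‖ +
          ‖∑ k ∈ Finset.range N, Ring.choose ((-ν : ℝ) : ℂ) k * w ^ k‖) * r ^ (2 * N) := by
            gcongr; exact norm_sub_le _ _
      _ ≤ A ^ (N + M) * 4 ^ ν * X + S * A ^ N * X := by rw [add_mul]; exact add_le_add t1' t2
      _ ≤ _ := by
        have : 0 ≤ C * X := by positivity
        linarith

/-! ### Coefficients and the abstract expansion -/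

theorem Ring.choose_neg_eq_neg_one_pow_mul (μ : ℝ) (k : ℕ) :
    Ring.choose (-(μ + 1)) k = (-1) ^ k * Ring.choose ((k : ℝ) + μ) k := by
  rw [Ring.choose_neg, show μ + 1 + (k : ℝ) - 1 = k + μ by ring]
  rcases Nat.even_or_odd k with h | h
  · rw [h.neg_one_pow, Int.negOnePow_even _ (by exact_mod_cast h)]; simp
  · rw [h.neg_one_pow, Int.negOnePow_odd _ (by exact_mod_cast h)]; simp

theorem Real.Gamma_add_div_eq_choose {μ : ℝ} (hμ : 0 < μ) (k : ℕ) :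
    Real.Gamma ((k : ℝ) + μ + 1) / ((k.factorial : ℝ) * Real.Gamma (μ + 1)) =
      Ring.choose ((k : ℝ) + μ) k := by
  have h : ∀ k : ℕ, Real.Gamma ((k : ℝ) + μ + 1) =
      (ascPochhammer ℝ k).eval (μ + 1) * Real.Gamma (μ + 1) := by
    intro k
    induction k with
    | zero => simp
    | succ k ih =>
      rw [show ((k + 1 : ℕ) : ℝ) + μ + 1 = (k + μ + 1) + 1 by push_cast; ring,
        Real.Gamma_add_one (by positivity), ih, ascPochhammer_succ_eval]
      ring
  have h2 := Ring.factorial_nsmul_multichoose_eq_ascPochhammer (μ + 1) k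
  rw [Ring.multichoose_eq, show μ + 1 + (k : ℝ) - 1 = k + μ by ring,
    Polynomial.ascPochhammer_smeval_eq_eval, nsmul_eq_mul] at h2
  have hG : Real.Gamma (μ + 1) ≠ 0 := (Real.Gamma_pos_of_pos (by linarith)).ne'
  rw [h, ← h2]
  field_simp

theorem isLittleO_rpow_rpow_atTop {a b : ℝ} (h : a < b) :
    (fun r : ℝ => r ^ a) =o[atTop] fun r : ℝ => r ^ b := by
  rw [isLittleO_iff_tendsto']
  · refine (tendsto_rpow_neg_atTop (sub_pos.2 h)).congr' ?_
    filter_upwards [eventually_gt_atTop 0] with r hr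
    rw [← Real.rpow_sub hr, neg_sub]
  · filter_upwards [eventually_gt_atTop 0] with r hr h0
    exact absurd h0 (Real.rpow_pos_of_pos hr _).ne'

theorem hasAsymptoticExpansion_integral {α : Type*} [MeasurableSpace α] {m : Measure α}
    {μ : ℝ} (hμ : 0 < μ) {W U : α → ℂ} (hU : ∀ a, 1 / 2 ≤ (U a).re)
    (hUm : AEStronglyMeasurable U m) (hWm : AEStronglyMeasurable W m)
    (hW : ∀ Q : ℕ, Integrable (fun a => ‖W a‖ * (1 + ‖U a‖) ^ Q) m) :
    HasAsymptoticExpansion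
      (fun r => ∫ a, W a * (2 * U a * (U a ^ 2 + (r : ℂ) ^ 2) ^ ((-(μ + 1) : ℝ) : ℂ)) ∂m)
      (fun k => ((2 * (-1) ^ k * Ring.choose ((k : ℝ) + μ) k : ℝ) : ℂ) *
        ∫ a, W a * U a ^ (2 * k + 1) ∂m)
      (fun k r => r ^ (-2 * (k : ℝ) - 2 * μ - 2)) := by
  refine ⟨fun k => isLittleO_rpow_rpow_atTop (by push_cast; linarith), fun N => ?_⟩
  -- Keeping the `N + 1` terms of index at most `N` leaves an error of the order of the next scale
  -- function, hence negligible against the one of index `N`.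
  obtain ⟨K, hK, Q, h⟩ := exists_norm_sq_add_sq_cpow_sub_sum_le (ν := μ + 1) (by linarith) (N + 1)
  have hWk : ∀ k : ℕ, Integrable (fun a => W a * U a ^ k) m := by
    intro k
    refine (hW k).mono (hWm.mul (hUm.pow k)) (Eventually.of_forall fun a => ?_)
    rw [norm_mul, norm_pow, Real.norm_of_nonneg (by positivity)]
    gcongr; linarith
  have hWf : ∀ r : ℝ, Integrable (fun a => W a * (2 * U a *
      (U a ^ 2 + (r : ℂ) ^ 2) ^ ((-(μ + 1) : ℝ) : ℂ))) m := by
    intro r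
    refine ((hW 1).const_mul (2 * 4 ^ (μ + 1))).mono ?_ (Eventually.of_forall fun a => ?_)
    · refine hWm.mul ((hUm.const_mul 2).mul ?_)
      exact (((hUm.pow 2).add_const _).aemeasurable.pow_const _).aestronglyMeasurable
    · have hre := hU a
      have hre' := hre.trans (Complex.re_le_norm (U a))
      have h1 := norm_sq_add_sq_cpow_neg_le (ν := μ + 1) (by linarith)
        (u := U a) (by linarith) r
      have h2 : (‖U a‖ * (U a).re) ^ (-(μ + 1)) ≤ (4 : ℝ) ^ (μ + 1) := by
        rw [Real.rpow_neg (by positivity), ← Real.inv_rpow (by positivity)]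
        refine Real.rpow_le_rpow (by positivity) ?_ (by linarith)
        rw [inv_le_comm₀ (by positivity) (by norm_num)]
        nlinarith
      rw [Real.norm_of_nonneg (by positivity), norm_mul, norm_mul, norm_mul, pow_one]
      calc _ ≤ ‖W a‖ * (2 * (1 + ‖U a‖) * 4 ^ (μ + 1)) := by
            gcongr
            · simp
            · linarith
            · exact h1.trans h2
        _ = _ := by ring
  set I := ∫ a, ‖W a‖ * (1 + ‖U a‖) ^ (Q + 1) ∂m
  have hO : (fun r : ℝ => (∫ a, W a * (2 * U a *
      (U a ^ 2 + (r : ℂ) ^ 2) ^ ((-(μ + 1) : ℝ) : ℂ)) ∂m) -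
      ∑ k ∈ Finset.range (N + 1), ((2 * (-1) ^ k * Ring.choose ((k : ℝ) + μ) k : ℝ) : ℂ) *
        (∫ a, W a * U a ^ (2 * k + 1) ∂m) * ((r ^ (-2 * (k : ℝ) - 2 * μ - 2) : ℝ) : ℂ)) =O[atTop]
      fun r : ℝ => r ^ (-2 * ((N + 1 : ℕ) : ℝ) - 2 * μ - 2) := by
    refine IsBigO.of_bound (2 * K * I) ?_
    filter_upwards [eventually_ge_atTop 1] with r hr
    have e : (∫ a, W a * (2 * U a * (U a ^ 2 + (r : ℂ) ^ 2) ^ ((-(μ + 1) : ℝ) : ℂ)) ∂m) -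
      ∑ k ∈ Finset.range (N + 1), ((2 * (-1) ^ k * Ring.choose ((k : ℝ) + μ) k : ℝ) : ℂ) *
        (∫ a, W a * U a ^ (2 * k + 1) ∂m) * ((r ^ (-2 * (k : ℝ) - 2 * μ - 2) : ℝ) : ℂ) =
      ∫ a, W a * (2 * U a) * ((U a ^ 2 + (r : ℂ) ^ 2) ^ ((-(μ + 1) : ℝ) : ℂ) -
        ∑ k ∈ Finset.range (N + 1), Ring.choose ((-(μ + 1) : ℝ) : ℂ) k * U a ^ (2 * k) *
          ((r ^ (-2 * (k : ℝ) - 2 * (μ + 1)) : ℝ) : ℂ)) ∂m := by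
      have e1 : ∀ k ∈ Finset.range (N + 1),
          ((2 * (-1) ^ k * Ring.choose ((k : ℝ) + μ) k : ℝ) : ℂ) *
          (∫ a, W a * U a ^ (2 * k + 1) ∂m) * ((r ^ (-2 * (k : ℝ) - 2 * μ - 2) : ℝ) : ℂ) =
          ∫ a, W a * U a ^ (2 * k + 1) * (2 * Ring.choose ((-(μ + 1) : ℝ) : ℂ) k *
          ((r ^ (-2 * (k : ℝ) - 2 * (μ + 1)) : ℝ) : ℂ)) ∂m := by
        intro k _
        rw [integral_mul_const, ← Complex.ofReal_choose, Ring.choose_neg_eq_neg_one_pow_mul,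
          show -2 * (k : ℝ) - 2 * (μ + 1) = -2 * (k : ℝ) - 2 * μ - 2 by ring]
        push_cast; ring
      rw [Finset.sum_congr rfl e1, ← integral_finsetSum _ fun k _ => (hWk _).mul_const _,
        ← integral_sub (hWf r) (integrable_finsetSum _ fun k _ => (hWk _).mul_const _)]
      congr 1
      ext a
      rw [mul_sub, Finset.mul_sum]
      congr 1
      · ring
      · exact Finset.sum_congr rfl fun k _ => by ring
    rw [e]
    have hr0 : 0 < r := by linarith
    rw [Real.norm_of_nonneg (by positivity), mul_comm (2 * K) I, mul_assoc,
      ← integral_mul_const]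
    refine norm_integral_le_of_norm_le ((hW _).mul_const _) (Eventually.of_forall fun a => ?_)
    have hb := h r hr (U a) (hU a)
    rw [norm_mul, norm_mul, norm_mul]
    rw [show -2 * ((N + 1 : ℕ) : ℝ) - 2 * (μ + 1) = -2 * ((N + 1 : ℕ) : ℝ) - 2 * μ - 2 by ring] at hb
    calc _ ≤ ‖W a‖ * (2 * (1 + ‖U a‖)) *
        (K * (1 + ‖U a‖) ^ Q * r ^ (-2 * ((N + 1 : ℕ) : ℝ) - 2 * μ - 2)) := by
          gcongr
          · simp
          · linarith
      _ = _ := by ring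
  exact hO.trans_isLittleO (isLittleO_rpow_rpow_atTop (by push_cast; linarith))

/-! ### Moving a vertical line across a simple pole -/

theorem integrable_inv_sq_add_quarter : Integrable fun t : ℝ => (t ^ 2 + 1 / 4)⁻¹ := by
  have h := (integrable_inv_one_add_sq.comp_mul_left' (R := (2 : ℝ)) (by norm_num)).const_mul 4
  refine h.congr (Eventually.of_forall fun t => ?_)
  have : t ^ 2 + 1 / 4 ≠ 0 := by positivity
  have : 1 + (2 * t) ^ 2 ≠ 0 := by positivity
  simp only
  field_simp
  ring

theorem integral_inv_sq_add_quarter : ∫ t : ℝ, (t ^ 2 + 1 / 4)⁻¹ = 2 * Real.pi := by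
  have h := Measure.integral_comp_mul_left (fun t : ℝ => (1 + t ^ 2)⁻¹) 2
  rw [integral_univ_inv_one_add_sq] at h
  have e : ∀ t : ℝ, (t ^ 2 + 1 / 4)⁻¹ = 4 * (1 + (2 * t) ^ 2)⁻¹ := fun t => by
    have : t ^ 2 + 1 / 4 ≠ 0 := by positivity
    have : 1 + (2 * t) ^ 2 ≠ 0 := by positivity
    field_simp
    ring
  simp_rw [e]
  rw [integral_const_mul, h, abs_of_pos (by norm_num), smul_eq_mul]
  ring

/-- Difference of the integrals over two vertical lines of a function with a single simple pole
between them. -/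
theorem integral_vertical_sub_integral_vertical {p : ℂ → ℂ}
    (hp : DifferentiableOn ℂ p {u | 0 < u.re ∧ u.re < 2})
    (h1 : Integrable fun t : ℝ => p (1 / 2 + t * Complex.I) / (1 / 2 + t * Complex.I - 1))
    (h2 : Integrable fun t : ℝ => p (3 / 2 + t * Complex.I) / (3 / 2 + t * Complex.I - 1))
    {B : ℝ → ℝ} (hB : Tendsto B atTop (nhds 0))
    (hpB : ∀ u : ℂ, 1 / 2 ≤ u.re → 1 ≤ |u.im| → ‖p u / (u - 1)‖ ≤ B |u.im|) :
    (∫ t : ℝ, p (1 / 2 + t * Complex.I) / (1 / 2 + t * Complex.I - 1)) -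
      ∫ t : ℝ, p (3 / 2 + t * Complex.I) / (3 / 2 + t * Complex.I - 1) =
    -(2 * Real.pi * p 1) := by
  set S : Set ℂ := {u | 0 < u.re ∧ u.re < 2} with hS
  have hSo : IsOpen S := (isOpen_lt continuous_const Complex.continuous_re).inter
    (isOpen_lt Complex.continuous_re continuous_const)
  have h1S : S ∈ nhds (1 : ℂ) := hSo.mem_nhds (by simp [hS])
  -- `H` is `p u / (u - 1)` with its polar part removed, so Cauchy's theorem applies to it. The
  -- polar parts on the two lines differ by `-p 1 / (t² + 1/4)`, whose integral supplies the
  -- residue.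
  set H := dslope p 1 with hH
  have hHd : DifferentiableOn ℂ H S := (Complex.differentiableOn_dslope h1S).2 hp
  have hHe : ∀ u : ℂ, u ≠ 1 → H u = p u / (u - 1) - p 1 / (u - 1) := by
    intro u hu
    rw [hH, dslope_of_ne _ hu, slope_def_field, sub_div]
  have hne1 : ∀ t : ℝ, (1 / 2 + t * Complex.I : ℂ) ≠ 1 := fun t h => by
    have := congrArg Complex.re h; norm_num at this
  have hne2 : ∀ t : ℝ, (3 / 2 + t * Complex.I : ℂ) ≠ 1 := fun t h => by
    have := congrArg Complex.re h; norm_num at this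
  set D : ℝ → ℂ := fun t => H (1 / 2 + t * Complex.I) - H (3 / 2 + t * Complex.I) with hD
  have hDe : ∀ t : ℝ, p (1 / 2 + t * Complex.I) / (1 / 2 + t * Complex.I - 1) -
      p (3 / 2 + t * Complex.I) / (3 / 2 + t * Complex.I - 1) =
      D t - p 1 * (((t ^ 2 + 1 / 4)⁻¹ : ℝ) : ℂ) := by
    intro t
    simp only [hD]
    rw [hHe _ (hne1 t), hHe _ (hne2 t)]
    have e : p 1 / (1 / 2 + t * Complex.I - 1) - p 1 / (3 / 2 + t * Complex.I - 1) =
        -(p 1 * (((t ^ 2 + 1 / 4)⁻¹ : ℝ) : ℂ)) := by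
      rw [div_sub_div _ _ (sub_ne_zero.2 (hne1 t)) (sub_ne_zero.2 (hne2 t))]
      have : (1 / 2 + (t : ℂ) * Complex.I - 1) * (3 / 2 + (t : ℂ) * Complex.I - 1) =
          -((t ^ 2 + 1 / 4 : ℝ) : ℂ) := by
        push_cast
        linear_combination (t : ℂ) ^ 2 * Complex.I_sq
      rw [this, div_neg]
      push_cast
      ring
    linear_combination e
  have hqi : Integrable fun t : ℝ => p 1 * (((t ^ 2 + 1 / 4)⁻¹ : ℝ) : ℂ) :=
    integrable_inv_sq_add_quarter.ofReal.const_mul _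
  have hDi : Integrable D := by
    refine ((h1.sub h2).add hqi).congr (Eventually.of_forall fun t => ?_)
    simp only [Pi.add_apply, Pi.sub_apply]
    rw [hDe]; ring
  have hD0 : ∫ t, D t = 0 := by
    have hlim := intervalIntegral_tendsto_integral hDi tendsto_neg_atTop_atBot tendsto_id
    refine tendsto_nhds_unique hlim ?_
    have hbd : Tendsto (fun T : ℝ => 2 * (B T + ‖p 1‖ / T)) atTop (nhds 0) := by
      have := (hB.add (tendsto_const_nhds.div_atTop (a := ‖p 1‖) tendsto_id)).const_mul 2
      simpa using this
    refine squeeze_zero_norm' ?_ hbd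
    filter_upwards [eventually_ge_atTop 1] with T hT
    simp only [id]
    have hrect := Complex.integral_boundary_rect_eq_zero_of_differentiableOn H
      (⟨1 / 2, -T⟩ : ℂ) (⟨3 / 2, T⟩ : ℂ) (hHd.mono ?_)
    · simp only at hrect
      have hH' : ∀ x y : ℝ, 1 / 2 ≤ x → 1 ≤ |y| → ‖H (x + y * Complex.I)‖ ≤ B |y| + ‖p 1‖ / |y| := by
        intro x y hx hy
        have him : (x + y * Complex.I : ℂ).im = y := by simp
        have hne : (x + y * Complex.I : ℂ) ≠ 1 := fun h => by
          have := congrArg Complex.im h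
          rw [him] at this
          rw [this] at hy; norm_num at hy
        rw [hHe _ hne]
        refine (norm_sub_le _ _).trans (add_le_add ?_ ?_)
        · have := hpB (x + y * Complex.I) (by simpa using hx) (by rwa [him])
          rwa [him] at this
        · rw [norm_div]
          gcongr
          have := Complex.abs_im_le_norm (x + y * Complex.I - 1 : ℂ)
          simpa using this
      have hv : ∀ x : ℝ, 0 < x → x < 2 →
          IntervalIntegrable (fun y : ℝ => H (x + y * Complex.I)) volume (-T) T := by
        intro x hx hx2
        refine Continuous.intervalIntegrable ?_ _ _
        exact hHd.continuousOn.comp_continuous (by fun_prop) (fun y => by simp [hS, hx, hx2])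
      have hab : ∀ y : ℝ, |y| = T → ‖∫ x : ℝ in (1 / 2)..(3 / 2), H (x + y * Complex.I)‖ ≤
          B T + ‖p 1‖ / T := by
        intro y hy
        have := intervalIntegral.norm_integral_le_of_norm_le_const (a := (1 / 2 : ℝ))
          (b := 3 / 2) (f := fun x : ℝ => H (x + y * Complex.I)) (C := B T + ‖p 1‖ / T)
          (fun x hx => by
            rw [Set.uIoc_of_le (by norm_num)] at hx
            have := hH' x y hx.1.le (by rw [hy]; exact hT)
            rwa [hy] at this)
        norm_num at this ⊢
        exact this
      have hb1 := hab (-T) (by rw [abs_neg, abs_of_nonneg (by linarith)])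
      have hb2 := hab T (abs_of_nonneg (by linarith))
      have hsplit : ∫ y : ℝ in (-T)..T, D y =
          (∫ y : ℝ in (-T)..T, H (((1 / 2 : ℝ) : ℂ) + y * Complex.I)) -
          ∫ y : ℝ in (-T)..T, H (((3 / 2 : ℝ) : ℂ) + y * Complex.I) := by
        rw [← intervalIntegral.integral_sub (hv _ (by norm_num) (by norm_num))
          (hv _ (by norm_num) (by norm_num))]
        simp [hD]
      rw [hsplit]
      rw [smul_eq_mul, smul_eq_mul] at hrect
      have hn : ‖Complex.I * ((∫ y : ℝ in (-T)..T, H (((1 / 2 : ℝ) : ℂ) + y * Complex.I)) -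
          ∫ y : ℝ in (-T)..T, H (((3 / 2 : ℝ) : ℂ) + y * Complex.I))‖ ≤
          2 * (B T + ‖p 1‖ / T) := by
        have e : Complex.I * ((∫ y : ℝ in (-T)..T, H (((1 / 2 : ℝ) : ℂ) + y * Complex.I)) -
          ∫ y : ℝ in (-T)..T, H (((3 / 2 : ℝ) : ℂ) + y * Complex.I)) =
          (∫ x : ℝ in (1 / 2)..(3 / 2), H (x + ((-T : ℝ) : ℂ) * Complex.I)) -
          ∫ x : ℝ in (1 / 2)..(3 / 2), H (x + (T : ℂ) * Complex.I) := by
          linear_combination -hrect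
        rw [e]
        refine (norm_sub_le _ _).trans ?_
        linarith
      rwa [norm_mul, Complex.norm_I, one_mul] at hn
    · intro u hu
      rw [Complex.mem_reProdIm] at hu
      have := hu.1
      rw [Set.uIcc_of_le (by norm_num)] at this
      exact ⟨by linarith [this.1], by linarith [this.2]⟩
  rw [← integral_sub h1 h2]
  simp_rw [hDe]
  rw [integral_sub hDi hqi, hD0, integral_const_mul, integral_complex_ofReal,
    integral_inv_sq_add_quarter]
  push_cast
  ring

/-! ### The Lindelöf kernel on the unit circle -/

theorem abs_arg_neg_lt_pi {z : ℂ} (hz : ‖z‖ = 1) (hz1 : z ≠ 1) : |Complex.arg (-z)| < Real.pi := by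
  refine lt_of_le_of_ne (Complex.abs_arg_le_pi _) fun h => hz1 ?_
  have h' : Complex.arg (-z) = Real.pi := by
    rcases (abs_eq Real.pi_pos.le).1 h with h | h
    · exact h
    · exact absurd h (Complex.neg_pi_lt_arg _).ne'
  obtain ⟨hre, him⟩ := Complex.arg_eq_pi_iff.1 h'
  simp only [Complex.neg_re, Complex.neg_im] at hre him
  have him' : z.im = 0 := by linarith
  have e : z = (z.re : ℂ) := Complex.ext rfl (by simp [him'])
  rw [e, Complex.norm_real, Real.norm_of_nonneg (by linarith)] at hz
  rw [e, hz]; simp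

theorem norm_neg_cpow_le {z : ℂ} (hz : ‖z‖ = 1) (u : ℂ) :
    ‖(-z) ^ u‖ ≤ Real.exp (|Complex.arg (-z)| * |u.im|) := by
  have hz0 : -z ≠ 0 := fun h => by simp [neg_eq_zero.1 h] at hz
  rw [Complex.norm_cpow_of_ne_zero hz0, norm_neg, hz, Real.one_rpow, one_div, ← Real.exp_neg,
    Real.exp_le_exp, ← abs_mul]
  exact neg_le_abs _

theorem exp_le_norm_sin_pi_mul {u : ℂ} (hu : u.re = 1 / 2 ∨ u.re = 3 / 2 ∨ 1 ≤ |u.im|) :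
    Real.exp (Real.pi * |u.im|) / 4 ≤ ‖Complex.sin (Real.pi * u)‖ := by
  have hline : ∀ t : ℝ, Real.exp (Real.pi * |t|) / 4 ≤ Real.cosh (Real.pi * t) := by
    intro t
    rw [← Real.cosh_abs, abs_mul, abs_of_pos Real.pi_pos, Real.cosh_eq]
    linarith [Real.exp_pos (Real.pi * |t|), Real.exp_pos (-(Real.pi * |t|))]
  have hc : ∀ t : ℝ, ‖Complex.cos (Real.pi * t * Complex.I)‖ = Real.cosh (Real.pi * t) := by
    intro t
    rw [Complex.cos_mul_I, ← Complex.ofReal_mul, ← Complex.ofReal_cosh, Complex.norm_real,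
      Real.norm_of_nonneg (Real.cosh_pos _).le]
  rcases hu with h | h | h
  · have e : (Real.pi : ℂ) * u = Real.pi * u.im * Complex.I + Real.pi / 2 := by
      conv_lhs => rw [← Complex.re_add_im u, h]
      push_cast; ring
    rw [e, Complex.sin_add_pi_div_two, hc]
    exact hline _
  · have e : (Real.pi : ℂ) * u = Real.pi * u.im * Complex.I + Real.pi / 2 + Real.pi := by
      conv_lhs => rw [← Complex.re_add_im u, h]
      push_cast; ring
    rw [e, Complex.sin_add_pi, Complex.sin_add_pi_div_two, norm_neg, hc]
    exact hline _
  · set y := Real.pi * u.im with hy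
    have n1 : ‖Complex.exp (-(Real.pi * u) * Complex.I)‖ = Real.exp y := by
      rw [Complex.norm_exp]; simp [hy]
    have n2 : ‖Complex.exp (Real.pi * u * Complex.I)‖ = Real.exp (-y) := by
      rw [Complex.norm_exp]; simp [hy]
    have hs : ‖Complex.sin (Real.pi * u)‖ = ‖Complex.exp (-(Real.pi * u) * Complex.I) -
        Complex.exp (Real.pi * u * Complex.I)‖ / 2 := by
      rw [Complex.sin]; simp
    have h3 := abs_norm_sub_norm_le (Complex.exp (-(Real.pi * u) * Complex.I))
      (Complex.exp (Real.pi * u * Complex.I))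
    rw [n1, n2] at h3
    have hpi := Real.pi_gt_three
    have hyabs : Real.pi * |u.im| = |y| := by rw [hy, abs_mul, abs_of_pos Real.pi_pos]
    have hy1 : 1 ≤ |y| := by rw [← hyabs]; nlinarith
    have hexp : Real.exp |y| / 2 ≤ |Real.exp y - Real.exp (-y)| := by
      have hg : ∀ s : ℝ, 1 ≤ s → Real.exp s / 2 ≤ Real.exp s - Real.exp (-s) := by
        intro s hs
        have a1 := Real.add_one_le_exp s
        have a2 : Real.exp (-s) ≤ 1 := Real.exp_le_one_iff.2 (by linarith)
        linarith
      rcases le_total 0 y with h0 | h0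
      · rw [abs_of_nonneg h0] at hy1 ⊢
        exact (hg y hy1).trans (le_abs_self _)
      · rw [abs_of_nonpos h0] at hy1 ⊢
        have := hg (-y) hy1
        rw [neg_neg] at this
        rw [abs_sub_comm]
        exact this.trans (le_abs_self _)
    rw [hyabs, hs]
    linarith

/-- The power grows at most at rate `|arg (-z)|` in `|Im u|`, while the sine grows at rate `π`. For
`z ≠ 1` the gap is positive, giving exponential decay. The three alternatives cover both vertical
lines and the distant horizontal sides of the contour. -/
theorem norm_lindelof_kernel_le {z : ℂ} (hz : ‖z‖ = 1) {u : ℂ}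
    (hu : u.re = 1 / 2 ∨ u.re = 3 / 2 ∨ 1 ≤ |u.im|) :
    ‖(-z) ^ u * (Real.pi / Complex.sin (Real.pi * u))‖ ≤
      4 * Real.pi * Real.exp (-((Real.pi - |Complex.arg (-z)|) * |u.im|)) := by
  have h1 := norm_neg_cpow_le hz u
  have h2 := exp_le_norm_sin_pi_mul hu
  have he : 0 < Real.exp (Real.pi * |u.im|) := Real.exp_pos _
  rw [norm_mul, norm_div, Complex.norm_real, Real.norm_of_nonneg Real.pi_pos.le]
  calc _ ≤ Real.exp (|Complex.arg (-z)| * |u.im|) *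
        (Real.pi / (Real.exp (Real.pi * |u.im|) / 4)) := by gcongr
    _ = 4 * Real.pi * (Real.exp (|Complex.arg (-z)| * |u.im|) *
        (Real.exp (Real.pi * |u.im|))⁻¹) := by field_simp
    _ = _ := by rw [← Real.exp_neg, ← Real.exp_add]; ring_nf

theorem integrable_exp_neg_mul_abs_mul_pow {b : ℝ} (hb : 0 < b) (Q : ℕ) :
    Integrable fun t : ℝ => Real.exp (-(b * |t|)) * (2 + |t|) ^ Q := by
  have hC : 0 ≤ Real.exp (2 * b) * ((Q + 2).factorial / b ^ (Q + 2)) := by positivity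
  refine (integrable_inv_one_add_sq.const_mul
    (Real.exp (2 * b) * ((Q + 2).factorial / b ^ (Q + 2)))).mono
    (Continuous.aestronglyMeasurable (by fun_prop)) (Eventually.of_forall fun t => ?_)
  rw [Real.norm_of_nonneg (by positivity), Real.norm_of_nonneg (by positivity)]
  have h0 := abs_nonneg t
  -- Degree `Q + 2` absorbs the weight and leaves an integrable `(2 + |t|)⁻²`.
  have hp := Real.pow_div_factorial_le_exp (b * (2 + |t|)) (by positivity) (Q + 2)
  have he : Real.exp (-(b * |t|)) = Real.exp (2 * b) * (Real.exp (b * (2 + |t|)))⁻¹ := by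
    rw [← Real.exp_neg, ← Real.exp_add]; ring_nf
  have hinv : (Real.exp (b * (2 + |t|)))⁻¹ ≤ ((b * (2 + |t|)) ^ (Q + 2) / (Q + 2).factorial)⁻¹ :=
    inv_anti₀ (by positivity) hp
  rw [he, mul_assoc, mul_assoc]
  refine mul_le_mul_of_nonneg_left ?_ (Real.exp_pos _).le
  calc _ ≤ ((b * (2 + |t|)) ^ (Q + 2) / (Q + 2).factorial)⁻¹ * (2 + |t|) ^ Q := by gcongr
    _ = ((Q + 2).factorial / b ^ (Q + 2)) * ((2 + |t|) ^ 2)⁻¹ := by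
      rw [mul_pow, pow_add (2 + |t|)]; field_simp
    _ ≤ _ := by
      gcongr
      nlinarith [sq_abs t]

theorem sin_pi_mul_ne_zero_of_re {u : ℂ} (h0 : 0 < u.re) (h2 : u.re < 2) (h1 : u ≠ 1) :
    Complex.sin (Real.pi * u) ≠ 0 := by
  intro h
  obtain ⟨k, hk⟩ := Complex.sin_eq_zero_iff.1 h
  have hpi : (Real.pi : ℂ) ≠ 0 := by exact_mod_cast Real.pi_ne_zero
  have hu : u = (k : ℂ) := mul_left_cancel₀ hpi (by rw [hk, mul_comm])
  rw [hu, Complex.intCast_re] at h0 h2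
  have : k = 1 := by
    have a : 0 < k := by exact_mod_cast h0
    have b : k < 2 := by exact_mod_cast h2
    omega
  exact h1 (by rw [hu, this]; simp)

theorem lindelof_kernel_add_one {z : ℂ} (hz : z ≠ 0) (u : ℂ) :
    (-z) ^ (u + 1) * (Real.pi / Complex.sin (Real.pi * (u + 1))) =
      z * ((-z) ^ u * (Real.pi / Complex.sin (Real.pi * u))) := by
  rw [Complex.cpow_add _ _ (neg_ne_zero.2 hz), Complex.cpow_one, mul_add, mul_one,
    Complex.sin_add_pi, div_neg]
  ring

theorem integrable_lindelof_kernel_mul {z : ℂ} (hz : ‖z‖ = 1) (hz1 : z ≠ 1) {f : ℂ → ℂ}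
    (hf : ContinuousOn f {u | 0 < u.re}) {M : ℝ} (hM : ∀ u : ℂ, 1 / 2 ≤ u.re → ‖f u‖ ≤ M)
    {x : ℝ} (hx : x = 1 / 2 ∨ x = 3 / 2) :
    Integrable fun t : ℝ => (-z) ^ (x + t * Complex.I : ℂ) *
      (Real.pi / Complex.sin (Real.pi * (x + t * Complex.I))) * f (x + t * Complex.I) := by
  have hz0 : -z ≠ 0 := fun h => by simp [neg_eq_zero.1 h] at hz
  have hb := sub_pos.2 (abs_arg_neg_lt_pi hz hz1)
  have hre : ∀ t : ℝ, (x + t * Complex.I : ℂ).re = x := fun t => by simp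
  have hx0 : 1 / 2 ≤ x := by rcases hx with rfl | rfl <;> norm_num
  have hu : ∀ t : ℝ, (x + t * Complex.I : ℂ).re = 1 / 2 ∨ (x + t * Complex.I : ℂ).re = 3 / 2 ∨
      1 ≤ |(x + t * Complex.I : ℂ).im| := fun t => by rw [hre]; tauto
  have hsin : ∀ t : ℝ, Complex.sin (Real.pi * (x + t * Complex.I)) ≠ 0 := fun t h => by
    have := exp_le_norm_sin_pi_mul (hu t)
    rw [h, norm_zero] at this
    linarith [Real.exp_pos (Real.pi * |(x + t * Complex.I : ℂ).im|)]
  have hM0 : 0 ≤ M := (norm_nonneg _).trans (hM 1 (by norm_num))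
  refine ((integrable_exp_neg_mul_abs_mul_pow hb 0).const_mul (4 * Real.pi * M)).mono
    (Continuous.aestronglyMeasurable ?_) (Eventually.of_forall fun t => ?_)
  · refine Continuous.mul (Continuous.mul ?_ ?_) ?_
    · exact (Continuous.const_cpow (by fun_prop) (Or.inl hz0))
    · exact continuous_const.div (by fun_prop) hsin
    · exact hf.comp_continuous (by fun_prop) (fun t => by simp; linarith)
  · have h1 := norm_lindelof_kernel_le hz (hu t)
    have him : (x + t * Complex.I : ℂ).im = t := by simp
    rw [him] at h1
    rw [norm_mul, pow_zero, mul_one, Real.norm_of_nonneg (by positivity)]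
    calc _ ≤ 4 * Real.pi * Real.exp (-((Real.pi - |Complex.arg (-z)|) * |t|)) * M := by
          gcongr; exact hM _ (by rw [hre]; exact hx0)
      _ = _ := by ring

theorem integral_lindelof_kernel_mul_eq {z : ℂ} (hz : ‖z‖ = 1) (hz1 : z ≠ 1) {f : ℂ → ℂ}
    (hf : DifferentiableOn ℂ f {u | 0 < u.re}) {M : ℝ} (hM : ∀ u : ℂ, 1 / 2 ≤ u.re → ‖f u‖ ≤ M) :
    ∫ t : ℝ, (-z) ^ (1 / 2 + t * Complex.I : ℂ) *
      (Real.pi / Complex.sin (Real.pi * (1 / 2 + t * Complex.I))) * f (1 / 2 + t * Complex.I) =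
    -(2 * Real.pi * (z * f 1)) + z * ∫ t : ℝ, (-z) ^ (1 / 2 + t * Complex.I : ℂ) *
      (Real.pi / Complex.sin (Real.pi * (1 / 2 + t * Complex.I))) *
        f (1 / 2 + t * Complex.I + 1) := by
  have hz0 : z ≠ 0 := fun h => by simp [h] at hz
  have hnz0 : -z ≠ 0 := neg_ne_zero.2 hz0
  have hM0 : 0 ≤ M := (norm_nonneg _).trans (hM 1 (by norm_num))
  have hb := sub_pos.2 (abs_arg_neg_lt_pi hz hz1)
  have hpi : (Real.pi : ℂ) ≠ 0 := by exact_mod_cast Real.pi_ne_zero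
  set S : Set ℂ := {u | 0 < u.re ∧ u.re < 2} with hS
  -- Dividing out the zero of the sine at `1` exhibits the integrand as `p u / (u - 1)` with `p`
  -- holomorphic in the strip and `p 1 = z * f 1`.
  set s : ℂ → ℂ := dslope (fun u => Complex.sin (Real.pi * u)) 1 with hs
  have hsd : DifferentiableOn ℂ s Set.univ :=
    (Complex.differentiableOn_dslope univ_mem).2 (Differentiable.differentiableOn (by fun_prop))
  have hs1 : s 1 = -Real.pi := by
    rw [hs, dslope_same]
    have : HasDerivAt (fun u : ℂ => Complex.sin (Real.pi * u))
        (Complex.cos (Real.pi * 1) * (Real.pi * 1)) 1 :=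
      ((hasDerivAt_id (1 : ℂ)).const_mul (Real.pi : ℂ)).csin
    rw [this.deriv, mul_one, Complex.cos_pi]; ring
  have hse : ∀ u : ℂ, u ≠ 1 → s u = Complex.sin (Real.pi * u) / (u - 1) := by
    intro u hu
    rw [hs, dslope_of_ne _ hu, slope_def_field, mul_one, Complex.sin_pi, sub_zero]
  have hs0 : ∀ u ∈ S, s u ≠ 0 := by
    intro u hu
    by_cases h : u = 1
    · rw [h, hs1]; exact neg_ne_zero.2 hpi
    · rw [hse u h]
      exact div_ne_zero (sin_pi_mul_ne_zero_of_re hu.1 hu.2 h) (sub_ne_zero.2 h)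
  set p : ℂ → ℂ := fun u => (-z) ^ u * (Real.pi / s u) * f u with hp
  have hpd : DifferentiableOn ℂ p S := by
    refine DifferentiableOn.mul (DifferentiableOn.mul ?_ ?_) (hf.mono fun u hu => hu.1)
    · exact fun u _ => (differentiableAt_id.const_cpow (Or.inl hnz0)).differentiableWithinAt
    · exact (differentiableOn_const _).div (hsd.mono (Set.subset_univ _)) hs0
  have hp1 : p 1 = z * f 1 := by
    simp only [hp]
    rw [hs1, Complex.cpow_one, div_neg, div_self hpi]; ring
  have hpe : ∀ u : ℂ, u ≠ 1 → p u / (u - 1) =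
      (-z) ^ u * (Real.pi / Complex.sin (Real.pi * u)) * f u := by
    intro u hu
    have := sub_ne_zero.2 hu
    simp only [hp]
    rw [hse u hu]
    field_simp
  have hne1 : ∀ t : ℝ, (1 / 2 + t * Complex.I : ℂ) ≠ 1 := fun t h => by
    have := congrArg Complex.re h; norm_num at this
  have hne2 : ∀ t : ℝ, (3 / 2 + t * Complex.I : ℂ) ≠ 1 := fun t h => by
    have := congrArg Complex.re h; norm_num at this
  have i1 := integrable_lindelof_kernel_mul hz hz1 hf.continuousOn hM (Or.inl rfl)
  have i2 := integrable_lindelof_kernel_mul hz hz1 hf.continuousOn hM (Or.inr rfl)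
  push_cast at i1 i2
  have main := integral_vertical_sub_integral_vertical hpd
    (i1.congr (Eventually.of_forall fun t => (hpe _ (hne1 t)).symm))
    (i2.congr (Eventually.of_forall fun t => (hpe _ (hne2 t)).symm))
    (B := fun T => 4 * Real.pi * Real.exp (-((Real.pi - |Complex.arg (-z)|) * T)) * M) ?_ ?_
  · simp_rw [hpe _ (hne1 _), hpe _ (hne2 _)] at main
    have e : ∀ t : ℝ, (3 / 2 + t * Complex.I : ℂ) = 1 / 2 + t * Complex.I + 1 := fun t => by ring
    simp_rw [e, lindelof_kernel_add_one hz0, mul_assoc z, integral_const_mul] at main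
    rw [hp1] at main
    linear_combination main
  · have : Tendsto (fun T => Real.exp (-((Real.pi - |Complex.arg (-z)|) * T))) atTop (nhds 0) :=
      Real.tendsto_exp_neg_atTop_nhds_zero.comp (tendsto_id.const_mul_atTop hb)
    simpa using (this.const_mul (4 * Real.pi)).mul_const M
  · intro u hre him
    have hu : u ≠ 1 := fun h => by rw [h] at him; norm_num at him
    rw [hpe u hu, norm_mul]
    gcongr
    · exact norm_lindelof_kernel_le hz (Or.inr (Or.inr him))
    · exact hM u hre

/-- The shift identity is applied to the translates `f (· + n)` and telescoped. Monotonicity of `B`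
bounds all translates by `B (1/2)`, and its limit kills the remaining integral. -/
theorem tendsto_sum_pow_mul_lindelof {z : ℂ} (hz : ‖z‖ = 1) (hz1 : z ≠ 1) {f : ℂ → ℂ}
    (hf : DifferentiableOn ℂ f {u | 0 < u.re}) {B : ℝ → ℝ}
    (hB : Tendsto B atTop (nhds 0)) (hBa : AntitoneOn B (Set.Ici (1 / 2)))
    (hfB : ∀ u : ℂ, 1 / 2 ≤ u.re → ‖f u‖ ≤ B u.re) :
    Tendsto (fun n : ℕ => ∑ k ∈ Finset.range n, z ^ (k + 1) * f ((k + 1 : ℕ) : ℂ)) atTop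
      (nhds (-(1 / (2 * Real.pi)) * ∫ t : ℝ, (-z) ^ (1 / 2 + t * Complex.I : ℂ) *
        (Real.pi / Complex.sin (Real.pi * (1 / 2 + t * Complex.I))) *
          f (1 / 2 + t * Complex.I))) := by
  have hpi : (Real.pi : ℂ) ≠ 0 := by exact_mod_cast Real.pi_ne_zero
  set J : ℕ → ℂ := fun n => ∫ t : ℝ, (-z) ^ (1 / 2 + t * Complex.I : ℂ) *
        (Real.pi / Complex.sin (Real.pi * (1 / 2 + t * Complex.I))) *
          f (1 / 2 + t * Complex.I + n) with hJ
  have hshift : ∀ n : ℕ, J n = -(2 * Real.pi * (z * f ((n + 1 : ℕ) : ℂ))) + z * J (n + 1) := by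
    intro n
    have := integral_lindelof_kernel_mul_eq hz hz1 (f := fun u => f (u + n)) (M := B (1 / 2)) ?_ ?_
    · simp only [hJ]
      rw [this]
      congr 4
      · push_cast; ring_nf
      · ext t; push_cast; ring_nf
    · refine hf.comp (by fun_prop) fun u hu => ?_
      have : (0 : ℝ) < u.re := hu
      have hn : (0 : ℝ) ≤ n := n.cast_nonneg
      simp only [Set.mem_ofPred_eq, Complex.add_re, Complex.natCast_re]
      linarith
    · intro u hu
      have hn : (0 : ℝ) ≤ n := n.cast_nonneg
      have hre : 1 / 2 ≤ (u + n).re := by simp only [Complex.add_re, Complex.natCast_re]; linarith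
      exact (hfB _ hre).trans (hBa (Set.mem_Ici.2 le_rfl) hre hre)
  have hsum : ∀ n : ℕ, ∑ k ∈ Finset.range n, z ^ (k + 1) * f ((k + 1 : ℕ) : ℂ) =
      -(1 / (2 * Real.pi)) * (J 0 - z ^ n * J n) := by
    intro n
    induction n with
    | zero => simp
    | succ n ih =>
      rw [Finset.sum_range_succ, ih]
      have : z ^ n * J n = z ^ n * (-(2 * Real.pi * (z * f ((n + 1 : ℕ) : ℂ))) + z * J (n + 1)) := by
        rw [← hshift]
      have e : z ^ (n + 1) * f ((n + 1 : ℕ) : ℂ) = -(1 / (2 * Real.pi)) *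
          (-(2 * Real.pi * (z ^ (n + 1) * f ((n + 1 : ℕ) : ℂ)))) := by field_simp
      rw [e, this]
      ring
  have hJ0 : J 0 = ∫ t : ℝ, (-z) ^ (1 / 2 + t * Complex.I : ℂ) *
        (Real.pi / Complex.sin (Real.pi * (1 / 2 + t * Complex.I))) *
          f (1 / 2 + t * Complex.I) := by simp [hJ]
  have hint := (integrable_lindelof_kernel_mul hz hz1 (f := fun _ => 1) continuousOn_const
    (M := 1) (by simp) (Or.inl rfl)).norm
  push_cast at hint
  simp only [mul_one] at hint
  have hJlim : Tendsto (fun n : ℕ => z ^ n * J n) atTop (nhds 0) := by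
    have hlim : Tendsto (fun n : ℕ => (∫ t : ℝ, ‖(-z) ^ (1 / 2 + t * Complex.I : ℂ) *
        (Real.pi / Complex.sin (Real.pi * (1 / 2 + t * Complex.I)))‖) * B (1 / 2 + n))
        atTop (nhds 0) := by
      have := (hB.comp (tendsto_atTop_add_const_left atTop (1 / 2 : ℝ)
        tendsto_natCast_atTop_atTop)).const_mul (∫ t : ℝ, ‖(-z) ^ (1 / 2 + t * Complex.I : ℂ) *
        (Real.pi / Complex.sin (Real.pi * (1 / 2 + t * Complex.I)))‖)
      simpa using this
    refine squeeze_zero_norm (fun n => ?_) hlim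
    rw [norm_mul, norm_pow, hz, one_pow, one_mul, ← integral_mul_const]
    refine norm_integral_le_of_norm_le (hint.mul_const _) (Eventually.of_forall fun t => ?_)
    rw [norm_mul]
    gcongr
    have hre : (1 / 2 + t * Complex.I + n : ℂ).re = 1 / 2 + n := by simp
    have := hfB (1 / 2 + t * Complex.I + n) (by rw [hre]; have := n.cast_nonneg (α := ℝ); linarith)
    rwa [hre] at this
  simp_rw [hsum]
  rw [← hJ0]
  simpa using (hJlim.const_sub (J 0)).const_mul (-(1 / (2 * (Real.pi : ℂ))))

/-! ### The Mathieu series inside the disk and on the circle -/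

theorem mathieuTerm_succ_eq (μ r : ℝ) (z : ℂ) (n : ℕ) :
    mathieuTerm μ r z (n + 1) = z ^ (n + 1) * (2 * ((n + 1 : ℕ) : ℂ) *
      (((n + 1 : ℕ) : ℂ) ^ 2 + (r : ℂ) ^ 2) ^ ((-(μ + 1) : ℝ) : ℂ)) := by
  have h0 : (0 : ℝ) ≤ ((n + 1 : ℕ) : ℝ) ^ 2 + r ^ 2 := by positivity
  have e : (((n + 1 : ℕ) : ℂ) ^ 2 + (r : ℂ) ^ 2) =
      (((((n + 1 : ℕ) : ℝ) ^ 2 + r ^ 2 : ℝ)) : ℂ) := by push_cast; rfl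
  rw [mathieuTerm, e, ← Complex.ofReal_cpow h0, Real.rpow_neg h0, Complex.ofReal_inv]
  ring

theorem summable_mathieuTerm {μ : ℝ} (hμ : 0 < μ) {z : ℂ} (hz : ‖z‖ ≤ 1) (r : ℝ) :
    Summable (fun n : ℕ => mathieuTerm μ r z (n + 1)) := by
  have hs : Summable fun n : ℕ => 2 * ((n + 1 : ℕ) : ℝ) ^ (-(2 * μ + 1)) :=
    ((summable_nat_add_iff 1).2 (Real.summable_nat_rpow.2 (by linarith))).mul_left 2
  refine Summable.of_norm_bounded hs fun n => ?_
  have hn : (0 : ℝ) < ((n + 1 : ℕ) : ℝ) := by positivity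
  have h := norm_sq_add_sq_cpow_neg_le (ν := μ + 1) (by linarith) (u := ((n + 1 : ℕ) : ℂ))
    (by simpa using hn) r
  rw [Complex.norm_natCast, Complex.natCast_re, ← pow_two, ← Real.rpow_natCast,
    ← Real.rpow_mul hn.le] at h
  rw [mathieuTerm_succ_eq, norm_mul, norm_mul, norm_mul, norm_pow, Complex.norm_natCast]
  calc _ ≤ 1 * (2 * ((n + 1 : ℕ) : ℝ) * ((n + 1 : ℕ) : ℝ) ^ (((2 : ℕ) : ℝ) * -(μ + 1))) := by
        gcongr
        · exact pow_le_one₀ (norm_nonneg _) hz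
        · simp
    _ = 2 * (((n + 1 : ℕ) : ℝ) ^ (1 : ℝ) *
        ((n + 1 : ℕ) : ℝ) ^ (((2 : ℕ) : ℝ) * -(μ + 1))) := by rw [Real.rpow_one]; ring
    _ = _ := by rw [← Real.rpow_add hn]; congr 2; push_cast; ring

theorem Complex.inv_cpow_neg_odd (u : ℂ) (k : ℕ) :
    (u ^ (-2 * (k : ℂ) - 1))⁻¹ = u ^ (2 * k + 1) := by
  rw [show -2 * (k : ℂ) - 1 = -((2 * k + 1 : ℕ) : ℂ) by push_cast; ring, Complex.cpow_neg,
    inv_inv, Complex.cpow_natCast]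

theorem integral_count_eq_tsum {g : ℕ → ℂ} (hg : Integrable g Measure.count) :
    ∫ n, g n ∂Measure.count = ∑' n, g n := by
  rw [integral_countable hg]
  simp [Measure.real]

theorem mathieuF_hasAsymptoticExpansion_of_norm_lt_one {μ : ℝ} (hμ : 0 < μ) {z : ℂ}
    (hz : ‖z‖ < 1) :
    HasAsymptoticExpansion (fun r : ℝ => mathieuF μ r z)
      (fun k : ℕ =>
        ((2 * (-1) ^ k * Ring.choose ((k : ℝ) + μ) k : ℝ) : ℂ) * polylog (-2 * (k : ℂ) - 1) z)
      (fun k r => r ^ (-2 * (k : ℝ) - 2 * μ - 2)) := by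
  have hQ : ∀ Q : ℕ, Integrable
      (fun n : ℕ => ‖z ^ (n + 1)‖ * (1 + ‖((n + 1 : ℕ) : ℂ)‖) ^ Q) Measure.count := by
    intro Q
    rw [integrable_count_iff]
    -- The weight is `(n + 2)^Q`, hence the shift by two; the surplus factor `‖z‖` is divided out,
    -- which is why `z = 0` is treated apart.
    have h := (summable_nat_add_iff 2).2
      (summable_pow_mul_geometric_of_norm_lt_one Q (r := ‖z‖) (by simpa using hz))
    refine Summable.of_norm ?_
    simp only [norm_norm, norm_mul, norm_pow]
    rcases eq_or_ne z 0 with rfl | hz0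
    · simp [summable_zero]
    refine (h.mul_left ‖z‖⁻¹).congr fun n => ?_
    have : ‖z‖ ≠ 0 := norm_ne_zero_iff.2 hz0
    rw [Complex.norm_natCast, Real.norm_of_nonneg (by positivity)]
    push_cast
    field_simp
    ring
  have h := hasAsymptoticExpansion_integral (m := Measure.count) hμ
    (W := fun n : ℕ => z ^ (n + 1)) (U := fun n : ℕ => ((n + 1 : ℕ) : ℂ))
    (fun n => by
      rw [Complex.natCast_re]; push_cast; linarith [n.cast_nonneg (α := ℝ)])
    (measurable_of_countable _).aestronglyMeasurable
    (measurable_of_countable _).aestronglyMeasurable hQ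
  convert h using 1
  · ext r
    rw [mathieuF, integral_count_eq_tsum]
    · simp_rw [mathieuTerm_succ_eq]
    · rw [integrable_count_iff]
      simpa only [mathieuTerm_succ_eq] using (summable_mathieuTerm hμ hz.le r).norm
  · ext k
    congr 1
    rw [polylog, if_pos hz, polylogSeries, integral_count_eq_tsum]
    · simp_rw [div_eq_mul_inv, Complex.inv_cpow_neg_odd]
    · refine (hQ (2 * k + 1)).mono (measurable_of_countable _).aestronglyMeasurable
        (Eventually.of_forall fun n => ?_)
      rw [norm_mul, norm_pow (_ : ℂ) (2 * k + 1), Real.norm_of_nonneg (by positivity)]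
      gcongr; linarith

theorem mathieuF_eq_lindelof_integral {μ : ℝ} (hμ : 0 < μ) {z : ℂ} (hz : ‖z‖ = 1) (hz1 : z ≠ 1)
    (r : ℝ) :
    mathieuF μ r z = -(1 / (2 * Real.pi)) * ∫ t : ℝ, (-z) ^ (1 / 2 + t * Complex.I : ℂ) *
        (Real.pi / Complex.sin (Real.pi * (1 / 2 + t * Complex.I))) *
          (2 * (1 / 2 + t * Complex.I) * ((1 / 2 + t * Complex.I) ^ 2 + (r : ℂ) ^ 2) ^
            ((-(μ + 1) : ℝ) : ℂ)) := by
  have hlim := tendsto_sum_pow_mul_lindelof hz hz1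
    (f := fun u => 2 * u * (u ^ 2 + (r : ℂ) ^ 2) ^ ((-(μ + 1) : ℝ) : ℂ))
    -- From `|u| (|u| Re u)^(-(μ+1)) = |u|^(-μ) (Re u)^(-(μ+1))` and `|u| ≥ 1/2`.
    (B := fun x => 2 * 2 ^ μ * x ^ (-(μ + 1))) ?_ ?_ ?_ ?_
  · refine tendsto_nhds_unique ?_ hlim
    have := (summable_mathieuTerm hμ hz.le r).hasSum.tendsto_sum_nat
    simpa only [mathieuF, mathieuTerm_succ_eq] using this
  · intro u hu
    have hu : 0 < u.re := hu
    refine DifferentiableAt.differentiableWithinAt ?_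
    exact (by fun_prop : DifferentiableAt ℂ (fun u : ℂ => 2 * u) u).mul
      ((by fun_prop : DifferentiableAt ℂ (fun u : ℂ => u ^ 2 + (r : ℂ) ^ 2) u).cpow_const
        (sq_add_sq_mem_slitPlane hu r))
  · simpa using (tendsto_rpow_neg_atTop (by linarith : 0 < μ + 1)).const_mul (2 * (2 : ℝ) ^ μ)
  · intro x hx y hy hxy
    have hx : (1 / 2 : ℝ) ≤ x := hx
    simp only
    gcongr ?_ * ?_
    exact Real.rpow_le_rpow_of_nonpos (by linarith) hxy (by linarith)
  · intro u hu
    have hu0 : 0 < u.re := by linarith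
    have hn : 1 / 2 ≤ ‖u‖ := hu.trans (Complex.re_le_norm u)
    have hn0 : 0 < ‖u‖ := by linarith
    have h := norm_sq_add_sq_cpow_neg_le (ν := μ + 1) (by linarith) hu0 r
    rw [Real.mul_rpow hn0.le hu0.le] at h
    have h2 : ‖u‖ ^ (-μ) ≤ (2 : ℝ) ^ μ := by
      rw [Real.rpow_neg hn0.le, ← Real.inv_rpow hn0.le]
      refine Real.rpow_le_rpow (by positivity) ?_ hμ.le
      rw [inv_le_comm₀ hn0 (by norm_num)]
      linarith
    have h3 : ‖u‖ * ‖u‖ ^ (-(μ + 1)) = ‖u‖ ^ (-μ) := by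
      nth_rw 1 [← Real.rpow_one ‖u‖]
      rw [← Real.rpow_add hn0]; congr 1; ring
    rw [norm_mul, norm_mul]
    calc _ ≤ 2 * ‖u‖ * (‖u‖ ^ (-(μ + 1)) * u.re ^ (-(μ + 1))) := by
          gcongr; simp
      _ = 2 * ‖u‖ ^ (-μ) * u.re ^ (-(μ + 1)) := by rw [← h3]; ring
      _ ≤ _ := by gcongr

theorem mathieuF_hasAsymptoticExpansion_of_norm_eq_one {μ : ℝ} (hμ : 0 < μ) {z : ℂ}
    (hz : ‖z‖ = 1) (hz1 : z ≠ 1) :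
    HasAsymptoticExpansion (fun r : ℝ => mathieuF μ r z)
      (fun k : ℕ =>
        ((2 * (-1) ^ k * Ring.choose ((k : ℝ) + μ) k : ℝ) : ℂ) * polylog (-2 * (k : ℂ) - 1) z)
      (fun k r => r ^ (-2 * (k : ℝ) - 2 * μ - 2)) := by
  have hb := sub_pos.2 (abs_arg_neg_lt_pi hz hz1)
  have hWi := (integrable_lindelof_kernel_mul hz hz1 (f := fun _ => 1) continuousOn_const
    (M := 1) (by simp) (Or.inl rfl)).const_mul (-(1 / (2 * (Real.pi : ℂ))))
  push_cast at hWi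
  simp only [mul_one] at hWi
  set U : ℝ → ℂ := fun t => 1 / 2 + t * Complex.I with hU
  -- The `i` of `du = i dt` has cancelled the one in `1/(2πi)`.
  set W : ℝ → ℂ := fun t => -(1 / (2 * Real.pi)) *
    ((-z) ^ U t * (Real.pi / Complex.sin (Real.pi * U t))) with hW
  have hUc : Continuous U := by fun_prop
  have hre : ∀ t, (U t).re = 1 / 2 := fun t => by simp [hU]
  have him : ∀ t, (U t).im = t := fun t => by simp [hU]
  have hQ : ∀ Q : ℕ, Integrable (fun t => ‖W t‖ * (1 + ‖U t‖) ^ Q) := by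
    intro Q
    refine ((integrable_exp_neg_mul_abs_mul_pow hb Q).const_mul 2).mono
      (hWi.aestronglyMeasurable.norm.mul
        (Continuous.aestronglyMeasurable (by fun_prop))) (Eventually.of_forall fun t => ?_)
    have hk := norm_lindelof_kernel_le hz (u := U t) (Or.inl (hre t))
    rw [him] at hk
    have hUn : ‖U t‖ ≤ 1 + |t| := by
      refine (Complex.norm_le_abs_re_add_abs_im _).trans ?_
      rw [hre, him, abs_of_pos (by norm_num)]
      linarith
    have hc : ‖(-(1 / (2 * Real.pi)) : ℂ)‖ = 1 / (2 * Real.pi) := by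
      rw [norm_neg, norm_div, norm_mul, Complex.norm_real, Real.norm_of_nonneg Real.pi_pos.le]
      simp
    rw [Real.norm_of_nonneg (by positivity), Real.norm_of_nonneg (by positivity)]
    simp only [hW]
    rw [norm_mul, hc]
    calc _ ≤ 1 / (2 * Real.pi) * (4 * Real.pi *
          Real.exp (-((Real.pi - |Complex.arg (-z)|) * |t|))) * (2 + |t|) ^ Q := by
          gcongr _ * ?_ * ?_ ^ Q
          linarith
      _ = _ := by
        have := Real.pi_ne_zero
        field_simp
        ring
  have h := hasAsymptoticExpansion_integral hμ (W := W) (U := U) (fun t => (hre t).ge)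
    hUc.aestronglyMeasurable hWi.aestronglyMeasurable hQ
  convert h using 1
  · ext r
    rw [mathieuF_eq_lindelof_integral hμ hz hz1, ← integral_const_mul]
    congr 1
    ext t
    simp only [hW, hU]
    ring
  · ext k
    congr 1
    have hpi : (Real.pi : ℂ) ≠ 0 := by exact_mod_cast Real.pi_ne_zero
    rw [polylog, if_neg (by rw [hz]; norm_num), lindelofIntegral, ← integral_const_mul]
    congr 1
    ext t
    simp only [lindelofIntegrand, hW, hU]
    rw [div_eq_mul_inv ((-z) ^ _), Complex.inv_cpow_neg_odd]
    field_simp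

theorem theorem2 (μ : ℝ) (hμ : 0 < μ) (z : ℂ) (hz1 : z ≠ 1) (hz : ‖z‖ ≤ 1) :
    (∀ r : ℝ, 0 < r → Summable (fun n : ℕ => mathieuTerm μ r z (n + 1))) ∧
    HasAsymptoticExpansion (fun r : ℝ => mathieuF μ r z)
      (fun k : ℕ =>
        ((2 * (-1) ^ k * Real.Gamma ((k : ℝ) + μ + 1) /
            ((k.factorial : ℝ) * Real.Gamma (μ + 1)) : ℝ) : ℂ) * polylog (-2 * (k : ℂ) - 1) z)
      (fun k r => r ^ (-2 * (k : ℝ) - 2 * μ - 2)) ∧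
    (∀ k : ℕ, Real.Gamma ((k : ℝ) + μ + 1) / ((k.factorial : ℝ) * Real.Gamma (μ + 1)) =
      Ring.choose ((k : ℝ) + μ) k) ∧
    HasAsymptoticExpansion (fun r : ℝ => mathieuF μ r z)
      (fun k : ℕ =>
        ((2 * (-1) ^ k * Ring.choose ((k : ℝ) + μ) k : ℝ) : ℂ) * polylog (-2 * (k : ℂ) - 1) z)
      (fun k r => r ^ (-2 * (k : ℝ) - 2 * μ - 2)) := by
  have hexp : HasAsymptoticExpansion (fun r : ℝ => mathieuF μ r z)
      (fun k : ℕ =>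
        ((2 * (-1) ^ k * Ring.choose ((k : ℝ) + μ) k : ℝ) : ℂ) * polylog (-2 * (k : ℂ) - 1) z)
      (fun k r => r ^ (-2 * (k : ℝ) - 2 * μ - 2)) := by
    rcases hz.lt_or_eq with h | h
    · exact mathieuF_hasAsymptoticExpansion_of_norm_lt_one hμ h
    · exact mathieuF_hasAsymptoticExpansion_of_norm_eq_one hμ h hz1
  refine ⟨fun r _ => summable_mathieuTerm hμ hz r, ?_, Real.Gamma_add_div_eq_choose hμ, hexp⟩
  simp_rw [mul_div_assoc, Real.Gamma_add_div_eq_choose hμ]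
  exact hexp
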